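/- Let $X$ be a real reflexive Banach space with dual $X^*$ and pairing $\langle\cdot,\cdot\rangle$. For a set-valued operator $A:X\rightrightarrows X^*$ put $\operatorname{gra}A=\{(x,x^*)\in X\times X^*: x^*\in Ax\}$, and let $-A$ be the operator $x\mapsto -(Ax)$. The operator $A$ is monotone if $\langle x-y,x^*-y^*\rangle\ge 0$ for all $(x,x^*),(y,y^*)\in\operatorname{gra}A$, and maximal monotone if moreover no monotone operator has a graph properly containing $\operatorname{gra}A$. A function $F:X\times X^*\to\,]-\infty,+\infty]$ is a representative of a maximal monotone operator $A$ if $F$ is lower semicontinuous and convex, if for all $(x,x^*)\in X\times X^*$ $$F(x,x^*)\ge\langle x,x^*\rangle\quad\text{and}\quad F^*(x^*,x):=\sup_{(y,y^*)\in X\times X^*}\big(\langle y,x^*\rangle+\langle x,y^*\rangle-F(y,y^*)\big)\ge\langle x,x^*\rangle,$$ and if $\operatorname{gra}A=\{(x,x^*):F(x,x^*)=\langle x,x^*\rangle\}$. Put $\operatorname{dom}F=\{F<+\infty\}$ and $\widehat F(x,x^*)=F(x,-x^*)$. For a subset $D$ of a real normed space, put $${}^{ic}D=\{a\in D:\ \forall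 x\in\operatorname{aff}(D-D)\ \exists\delta>0\ \forall\lambda\in[0,\delta]\ \ a+\lambda x\in D\}$$ if the affine hull $\operatorname{aff}D$ is closed, and ${}^{ic}D=\varnothing$ otherwise; $\operatorname{conv}$ denotes the convex hull and $C-D=\{c-d:c\in C,\ d\in D\}$. Theorem. Let $A,B:X\rightrightarrows X^*$ be maximal monotone, and let $F_1,F_2$ be representatives of $A,B$, respectively. Then $${}^{ic}\big[\operatorname{dom}F_1-\operatorname{dom}\widehat{F_2}\big]={}^{ic}\big[\operatorname{conv}(\operatorname{gra}A-\operatorname{gra}(-B))\big]={}^{ic}\big[\operatorname{gra}A-\operatorname{gra}(-B)\big],$$ including the case where these sets are empty. -/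

import Mathlib

open scoped Pointwise

noncomputable section

namespace MaxMono

section Convex

variable {E : Type*} [NormedAddCommGroup E] [NormedSpace ℝ E]

/-- The effective domain of an extended-real-valued function. -/
def effDom (f : E → EReal) : Set E := {x | f x < ⊤}

/-- Convexity of a function with values in `]-∞, +∞]`. -/
def IsConvexFun (f : E → EReal) : Prop :=
  ∀ x y : E, ∀ a b : ℝ, 0 < a → 0 < b → a + b = 1 →
    f (a • x + b • y) ≤ (a : EReal) * f x + (b : EReal) * f y

/-- The Fenchel conjugate. -/
def fenchelConj (f : E → EReal) (φ : StrongDual ℝ E) : EReal :=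
  ⨆ x : E, ((φ x : ℝ) : EReal) - f x

/-- The intrinsic core (relative algebraic interior) `ⁱD` of a set. -/
def intrinsicCore (D : Set E) : Set E :=
  {a | a ∈ D ∧ ∀ x ∈ affineSpan ℝ (D - D),
    ∃ δ : ℝ, 0 < δ ∧ ∀ t ∈ Set.Icc (0 : ℝ) δ, a + t • x ∈ D}

/-- The set `ⁱᶜD`: it is `ⁱD` if the affine hull of `D` is closed, and empty otherwise. -/
def ic (D : Set E) : Set E :=
  {a | IsClosed (affineSpan ℝ D : Set E) ∧ a ∈ intrinsicCore D}

end Convex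

section Operators

variable {X : Type*} [NormedAddCommGroup X] [NormedSpace ℝ X]

/-- Reflexivity: the canonical map into the bidual is onto. -/
def IsReflexiveSpace (X : Type*) [NormedAddCommGroup X] [NormedSpace ℝ X] : Prop :=
  Function.Surjective (NormedSpace.inclusionInDoubleDual ℝ X)

/-- The graph of a set-valued operator `A : X ⇉ X*`. -/
def graph (A : X → Set (StrongDual ℝ X)) : Set (X × StrongDual ℝ X) :=
  {p | p.2 ∈ A p.1}

/-- Monotone set-valued operators. -/
def IsMonotoneOp (A : X → Set (StrongDual ℝ X)) : Prop :=
  ∀ p ∈ graph A, ∀ q ∈ graph A, 0 ≤ (p.2 - q.2) (p.1 - q.1)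

/-- Maximal monotone: monotone, with no proper monotone extension (for graph inclusion). -/
def IsMaximalMonotoneOp (A : X → Set (StrongDual ℝ X)) : Prop :=
  IsMonotoneOp A ∧
    ∀ T : X → Set (StrongDual ℝ X), IsMonotoneOp T → graph A ⊆ graph T → graph T = graph A

/-- The functional `(y, y*) ↦ ⟨y, x*⟩ + ⟨x, y*⟩` on `X × X*` given by `(x*, x)`;
for reflexive `X` this identifies `X* × X` with the dual of `X × X*`. -/
def dualPair (xs : StrongDual ℝ X) (x : X) : StrongDual ℝ (X × StrongDual ℝ X) :=
  xs.coprod (NormedSpace.inclusionInDoubleDual ℝ X x)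

/-- `F : X × X* → ]-∞, +∞]` is a representative of the operator `A`. -/
structure IsRepresentative (F : X × StrongDual ℝ X → EReal) (A : X → Set (StrongDual ℝ X)) :
    Prop where
  ne_bot : ∀ p, F p ≠ ⊥
  lsc : LowerSemicontinuous F
  convex : IsConvexFun F
  ge_pairing : ∀ (x : X) (xs : StrongDual ℝ X), ((xs x : ℝ) : EReal) ≤ F (x, xs)
  conj_ge_pairing : ∀ (x : X) (xs : StrongDual ℝ X),
    ((xs x : ℝ) : EReal) ≤ fenchelConj F (dualPair xs x)
  graph_eq : graph A = {p | F p = ((p.2 p.1 : ℝ) : EReal)}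

/-- The function `(x, x*) ↦ F (x, -x*)`. -/
def hat (F : X × StrongDual ℝ X → EReal) : X × StrongDual ℝ X → EReal :=
  fun p => F (p.1, -p.2)

end Operators

end MaxMono

end

/-! Write C = gra A - gra(-B) and D = dom F₁ - dom F̂₂, so that C ⊆ conv C ⊆ D with D convex. The
equalities follow from the cycle ic D ⊆ ic C ⊆ ic (conv C) ⊆ ic D, which rests on two facts.

ic D ⊆ C (`ic_effDom_sub_subset`): for a in ic D, the Attouch–Brezis theorem puts an affine function
between F₁ and the negative of a shifted, tilted copy of F̂₂. Its slope (y*, y) bounds F₁* and F₂*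
at two points. Both conjugates dominate the pairing and the bounds add up to the sum of the
pairings, so equality holds. Maximality then puts (y, y*) in gra A and (y - a₁, a₂ - y*) in gra B,
which decomposes a.

D ⊆ closure (aff C) (`effDom_sub_subset_closure`): a functional separating a point of D from aff C
is constant on both graphs. Maximality makes the graphs invariant along the corresponding direction,
and the Fitzpatrick bound extends the constancy to the domains, a contradiction. -/

noncomputable section

namespace MaxMono

/-! ### Baire category and open mapping for convex sets -/

section Convex

variable {E : Type*} [NormedAddCommGroup E] [NormedSpace ℝ E]
variable {G : Type*} [NormedAddCommGroup G] [NormedSpace ℝ G]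

/-- A continuous linear image of a bounded closed convex set in a complete space which is dense in
a ball of a subspace contains the ball of half the radius. -/
theorem mem_image_of_dense_ball [CompleteSpace G] (T : G →L[ℝ] E) {K : Set G}
    (hK : IsClosed K) (hc : Convex ℝ K) (hb : Bornology.IsBounded K) (V : Submodule ℝ E)
    (hTV : ∀ k ∈ K, T k ∈ V) {r : ℝ} (hr : 0 < r)
    (hd : ∀ v ∈ V, ‖v‖ ≤ r → v ∈ closure (T '' K)) :
    ∀ v ∈ V, ‖v‖ ≤ r / 2 → v ∈ T '' K := by
  intro v hv hvr
  have step : ∀ u : {u : E // u ∈ V ∧ ‖u‖ ≤ r}, ∃ k ∈ K, ‖(u : E) - T k‖ ≤ r / 2 := by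
    rintro ⟨u, hu, hur⟩
    obtain ⟨_, ⟨k, hk, rfl⟩, hlt⟩ := Metric.mem_closure_iff.1 (hd u hu hur) (r / 2) (by positivity)
    exact ⟨k, hk, by rw [← dist_eq_norm]; exact hlt.le⟩
  choose κ hκK hκ using step
  -- Successive approximation: the residual has norm at most r / 2, so doubling it returns to the
  -- ball.
  let next : {u : E // u ∈ V ∧ ‖u‖ ≤ r} → {u : E // u ∈ V ∧ ‖u‖ ≤ r} := fun u =>
    ⟨(2 : ℝ) • ((u : E) - T (κ u)), V.smul_mem _ (V.sub_mem u.2.1 (hTV _ (hκK u))), by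
      rw [norm_smul, Real.norm_of_nonneg (by norm_num)]; linarith [hκ u]⟩
  let u₀ : {u : E // u ∈ V ∧ ‖u‖ ≤ r} := ⟨(2 : ℝ) • v, V.smul_mem _ hv, by
    rw [norm_smul, Real.norm_of_nonneg (by norm_num)]; linarith⟩
  let u : ℕ → {u : E // u ∈ V ∧ ‖u‖ ≤ r} := fun n => next^[n] u₀
  have hu : ∀ n, ((u (n + 1) : E)) = (2 : ℝ) • ((u n : E) - T (κ (u n))) := fun n => by
    simp only [u, Function.iterate_succ_apply', next]
  let s : ℕ → G := fun n => ∑ i ∈ Finset.range n, ((1 : ℝ) / 2) ^ (i + 1) • κ (u i)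
  have hs : ∀ n, s (n + 1) = s n + ((1 : ℝ) / 2) ^ (n + 1) • κ (u n) := fun n =>
    Finset.sum_range_succ _ _
  -- The weights 1/2, …, 1/2ⁿ, 1/2ⁿ sum to 1; the extra point k completes the convex combination, as
  -- 0 need not lie in K.
  have hsK : ∀ n, ∀ k ∈ K, s n + ((1 : ℝ) / 2) ^ n • k ∈ K := by
    intro n
    induction n with
    | zero => intro k hk; simpa [s] using hk
    | succ n ih =>
      intro k hk
      have := ih _ (hc (hκK (u n)) hk (by norm_num : (0 : ℝ) ≤ 1 / 2)
        (by norm_num : (0 : ℝ) ≤ 1 / 2) (by norm_num))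
      convert this using 1
      rw [hs]
      module
  have hsT : ∀ n, T (s n) = v - ((1 : ℝ) / 2) ^ (n + 1) • (u n : E) := by
    intro n
    induction n with
    | zero => simp [s, u, u₀, smul_smul]
    | succ n ih =>
      rw [hs, map_add, map_smul, ih, hu]
      module
  obtain ⟨R, hR⟩ := hb.exists_norm_le
  have hcau : CauchySeq s := by
    refine cauchySeq_of_le_geometric (1 / 2) (R / 2) (by norm_num) fun n => ?_
    rw [hs, dist_self_add_right, norm_smul, Real.norm_of_nonneg (by positivity)]
    have := hR _ (hκK (u n))
    have h2 : (0 : ℝ) < (1 / 2) ^ n := by positivity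
    rw [pow_succ]
    nlinarith
  obtain ⟨k, hk⟩ := cauchySeq_tendsto_of_complete hcau
  have hpow : Filter.Tendsto (fun n : ℕ => ((1 : ℝ) / 2) ^ n) Filter.atTop (nhds 0) :=
    tendsto_pow_atTop_nhds_zero_of_lt_one (by norm_num) (by norm_num)
  have hkK : k ∈ K := by
    have h1 := hk.add (hpow.smul_const (κ u₀))
    rw [zero_smul, add_zero] at h1
    exact hK.mem_of_tendsto h1 (Filter.Eventually.of_forall fun n => hsK n _ (hκK u₀))
  refine ⟨k, hkK, ?_⟩
  have h1 : Filter.Tendsto (fun n => T (s n)) Filter.atTop (nhds (T k)) :=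
    (T.continuous.tendsto k).comp hk
  refine tendsto_nhds_unique h1 ?_
  have h2 : Filter.Tendsto (fun n => ((1 : ℝ) / 2) ^ (n + 1) • (u n : E)) Filter.atTop
      (nhds 0) := by
    refine squeeze_zero_norm (a := fun n => ((1 : ℝ) / 2) ^ (n + 1) * r) (fun n => ?_) ?_
    · rw [norm_smul, Real.norm_of_nonneg (by positivity)]
      exact mul_le_mul_of_nonneg_left (u n).2.2 (by positivity)
    · simpa using ((Filter.tendsto_add_atTop_iff_nat 1).2 hpow).mul_const r
  simp_rw [hsT]
  simpa using h2.const_sub v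

/-- If the continuous linear image of a closed convex set in a Banach space is absorbing in a closed
subspace, then the image of a bounded part of the set contains a ball of that subspace. -/
theorem exists_ball_subset_image [CompleteSpace E] [CompleteSpace G] (T : G →L[ℝ] E) {K : Set G}
    (hK : IsClosed K) (hc : Convex ℝ K) (V : Submodule ℝ E) (hV : IsClosed (V : Set E))
    (hTV : ∀ k ∈ K, T k ∈ V)
    (habs : ∀ v ∈ V, ∃ δ : ℝ, 0 < δ ∧ ∀ t ∈ Set.Icc (0 : ℝ) δ, t • v ∈ T '' K) :
    ∃ r : ℝ, 0 < r ∧ ∃ N : ℝ, ∀ v ∈ V, ‖v‖ ≤ r → ∃ k ∈ K, ‖k‖ ≤ N ∧ T k = v := by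
  have : CompleteSpace V := hV.completeSpace_coe
  let KN : ℝ → Set G := fun N => K ∩ Metric.closedBall 0 N
  let f : ℕ × ℕ → Set V := fun p =>
    {v | ((1 : ℝ) / (p.1 + 1)) • (v : E) ∈ closure (T '' KN p.2)}
  have hf : ∀ p, IsClosed (f p) := fun p =>
    isClosed_closure.preimage (by fun_prop : Continuous fun v : V =>
      ((1 : ℝ) / (p.1 + 1)) • (v : E))
  have hcov : ⋃ p, f p = Set.univ := by
    refine Set.eq_univ_of_forall fun v => Set.mem_iUnion.2 ?_
    obtain ⟨δ, hδ, h⟩ := habs v v.2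
    obtain ⟨m, hm⟩ := exists_nat_one_div_lt hδ
    obtain ⟨g, hg, hgv⟩ := h (1 / ((m : ℝ) + 1)) ⟨by positivity, hm.le⟩
    obtain ⟨n, hn⟩ := exists_nat_ge ‖g‖
    exact ⟨(m, n), subset_closure ⟨g, ⟨hg, by simpa using hn⟩, hgv⟩⟩
  obtain ⟨⟨m, n⟩, v₀, hv₀⟩ := nonempty_interior_of_iUnion_of_closed hf hcov
  obtain ⟨ε, hε, hball⟩ := Metric.isOpen_iff.1 isOpen_interior v₀ hv₀
  obtain ⟨δ, hδ, h⟩ := habs (-v₀) (V.neg_mem v₀.2)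
  obtain ⟨g, hg, hgv⟩ := h δ ⟨hδ.le, le_rfl⟩
  set t : ℝ := 1 / ((m : ℝ) + 1) with ht
  have ht0 : 0 < t := by positivity
  set N : ℝ := max n ‖g‖
  have hKc : Convex ℝ (KN N) := hc.inter (convex_closedBall _ _)
  have hcl : Convex ℝ (closure (T '' KN N)) := (hKc.linear_image (T : G →ₗ[ℝ] E)).closure
  -- This weight gives l t = (1 - l) δ, so v₀ cancels and the Baire ball around v₀ is moved to the
  -- origin.
  set l : ℝ := δ / (t + δ) with hl
  have hl0 : 0 < l := by positivity
  have hl1 : 1 - l = t / (t + δ) := by rw [hl]; field_simp; ring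
  have hd : ∀ v ∈ V, ‖v‖ ≤ l * t * (ε / 2) → v ∈ closure (T '' KN N) := by
    intro v hv hvn
    have h1 : t • ((v₀ : E) + (l * t)⁻¹ • v) ∈ closure (T '' KN N) := by
      have h2 : v₀ + (l * t)⁻¹ • (⟨v, hv⟩ : V) ∈ f (m, n) := by
        refine interior_subset (hball ?_)
        rw [Metric.mem_ball, dist_self_add_left, norm_smul, norm_inv,
          Real.norm_of_nonneg (by positivity)]
        have : ‖(⟨v, hv⟩ : V)‖ ≤ l * t * (ε / 2) := hvn
        rw [inv_mul_lt_iff₀ (by positivity)]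
        have : 0 < l * t * ε := by positivity
        linarith
      have h3 : t • ((v₀ : E) + (l * t)⁻¹ • v) ∈ closure (T '' KN n) := h2
      exact closure_mono (Set.image_mono (Set.inter_subset_inter_right _
        (Metric.closedBall_subset_closedBall (le_max_left _ _)))) h3
    have h2 : δ • -(v₀ : E) ∈ closure (T '' KN N) :=
      subset_closure ⟨g, ⟨hg, by simp [N]⟩, hgv⟩
    have h3 := hcl h1 h2 hl0.le (by rw [hl1]; positivity : (0 : ℝ) ≤ 1 - l) (by ring)
    convert h3 using 1
    have h4 : l * t = (1 - l) * δ := by rw [hl1, hl]; field_simp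
    have h5 : l • t • ((v₀ : E) + (l * t)⁻¹ • v) + (1 - l) • δ • -(v₀ : E)
        = (l * t - (1 - l) * δ) • (v₀ : E) + ((l * t) * (l * t)⁻¹) • v := by module
    rw [h5, h4, sub_self, zero_smul, zero_add, mul_inv_cancel₀ (by rw [← h4]; positivity), one_smul]
  refine ⟨l * t * (ε / 2) / 2, by positivity, N, fun v hv hvn => ?_⟩
  obtain ⟨k, ⟨hk, hkN⟩, hkv⟩ := mem_image_of_dense_ball T (hK.inter Metric.isClosed_closedBall) hKc
    (Metric.isBounded_closedBall.subset Set.inter_subset_right) V (fun k hk => hTV k hk.1)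
    (by positivity) hd v hv hvn
  exact ⟨k, hk, by simpa using hkN, hkv⟩

end Convex

/-! ### Calculus of `ic` and the sandwich theorem -/

section Convex

variable {E : Type*} [NormedAddCommGroup E] [NormedSpace ℝ E]

theorem coe_affineSpan_sub_self {D : Set E} (hD : D.Nonempty) :
    (affineSpan ℝ (D - D) : Set E) = vectorSpan ℝ D := by
  have h0 : (0 : E) ∈ D - D := by
    obtain ⟨d, hd⟩ := hD
    exact ⟨d, hd, d, hd, sub_self d⟩
  have h1 : D -ᵥ D = D - D := rfl
  rw [vectorSpan_def, h1, ← affineSpan_insert_zero, Set.insert_eq_of_mem h0]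

theorem mem_ic_iff {D : Set E} {a : E} :
    a ∈ ic D ↔ a ∈ D ∧ IsClosed (affineSpan ℝ D : Set E) ∧
      ∀ x ∈ vectorSpan ℝ D, ∃ δ : ℝ, 0 < δ ∧ ∀ t ∈ Set.Icc (0 : ℝ) δ, a + t • x ∈ D := by
  by_cases ha : a ∈ D
  · have h : ∀ x, x ∈ affineSpan ℝ (D - D) ↔ x ∈ vectorSpan ℝ D := fun x =>
      Set.ext_iff.1 (coe_affineSpan_sub_self ⟨a, ha⟩) x
    simp only [ic, intrinsicCore, Set.mem_ofPred_eq, h]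
    tauto
  · simp [ic, intrinsicCore, ha]

/-- A point of `ic C` forces aff C to be closed, so C and D have the same affine hull and the same
directions to test. -/
theorem ic_subset_ic_of_subset_closure {C D : Set E} (hCD : C ⊆ D)
    (hD : D ⊆ closure (affineSpan ℝ C)) : ic C ⊆ ic D := by
  intro a ha
  obtain ⟨haC, hcl, h⟩ := mem_ic_iff.1 ha
  rw [hcl.closure_eq] at hD
  have haff : affineSpan ℝ D = affineSpan ℝ C :=
    le_antisymm (affineSpan_le.2 hD) (affineSpan_mono ℝ hCD)
  have hvec : vectorSpan ℝ D = vectorSpan ℝ C := by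
    rw [← direction_affineSpan, haff, direction_affineSpan]
  refine mem_ic_iff.2 ⟨hCD haC, haff ▸ hcl, fun x hx => ?_⟩
  obtain ⟨δ, hδ, h⟩ := h x (hvec ▸ hx)
  exact ⟨δ, hδ, fun t ht => hCD (h t ht)⟩

/-- The set `ic D` of a convex set `D` absorbs segments towards each of its points. -/
theorem add_smul_sub_mem_ic {D : Set E} (hD : Convex ℝ D) {a d : E} (ha : a ∈ ic D) (hd : d ∈ D)
    {t : ℝ} (ht0 : 0 ≤ t) (ht1 : t < 1) : a + t • (d - a) ∈ ic D := by
  obtain ⟨haD, hcl, h⟩ := mem_ic_iff.1 ha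
  refine mem_ic_iff.2 ⟨hD.add_smul_sub_mem haD hd ⟨ht0, ht1.le⟩, hcl, fun x hx => ?_⟩
  obtain ⟨δ, hδ, h⟩ := h x hx
  have h1 : 0 < 1 - t := by linarith
  refine ⟨(1 - t) * δ, by positivity, fun s hs => ?_⟩
  have h2 := h (s / (1 - t)) ⟨div_nonneg hs.1 h1.le, (div_le_iff₀ h1).2 (by linarith [hs.2])⟩
  have h3 := hD h2 hd h1.le ht0 (by ring)
  convert h3 using 1
  have h4 : (1 - t) * (s / (1 - t)) = s := by field_simp
  have h5 : (1 - t) • (a + (s / (1 - t)) • x) + t • d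
    = a + t • (d - a) + ((1 - t) * (s / (1 - t))) • x := by module
  rw [h5, h4]

/-- From a in `ic D`, the midpoint towards any d in D is again in `ic D`, hence in C; extrapolating
recovers d, so the affine hulls agree. -/
theorem ic_subset_ic_of_ic_subset {C D : Set E} (hD : Convex ℝ D) (hC : ic D ⊆ C) (hCD : C ⊆ D) :
    ic D ⊆ ic C := by
  intro a ha
  obtain ⟨haD, hcl, h⟩ := mem_ic_iff.1 ha
  have haff : affineSpan ℝ C = affineSpan ℝ D := by
    refine le_antisymm (affineSpan_mono ℝ hCD) (affineSpan_le.2 fun d hd => ?_)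
    have h1 : a ∈ affineSpan ℝ C := subset_affineSpan ℝ C (hC ha)
    have h2 : a + (1 / 2 : ℝ) • (d - a) ∈ affineSpan ℝ C := subset_affineSpan ℝ C
      (hC (add_smul_sub_mem_ic hD ha hd (by norm_num) (by norm_num)))
    have h3 := AffineMap.lineMap_mem (2 : ℝ) h1 h2
    rw [AffineMap.lineMap_apply_module'] at h3
    rwa [show (2 : ℝ) • (a + (1 / 2 : ℝ) • (d - a) - a) + a = d by module] at h3
  have hvec : vectorSpan ℝ C = vectorSpan ℝ D := by
    rw [← direction_affineSpan, haff, direction_affineSpan]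
  refine mem_ic_iff.2 ⟨hC ha, haff ▸ hcl, fun x hx => ?_⟩
  obtain ⟨δ, hδ, h⟩ := h x (hvec ▸ hx)
  refine ⟨δ / 2, by positivity, fun t ht => hC ?_⟩
  have h1 := add_smul_sub_mem_ic hD ha (h δ ⟨hδ.le, le_rfl⟩) (t := t / δ)
    (div_nonneg ht.1 hδ.le) ((div_lt_one hδ).2 (by linarith [ht.2]))
  convert h1 using 1
  rw [add_sub_cancel_left, smul_smul, div_mul_cancel₀ _ hδ.ne']

/-- The Attouch–Brezis sandwich theorem, for two closed convex sets in the role of epigraphs. -/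
theorem exists_affine_between [CompleteSpace E] {P Q : Set (E × ℝ)}
    (hP : IsClosed P) (hPc : Convex ℝ P) (hQ : IsClosed Q) (hQc : Convex ℝ Q)
    (h0 : 0 ∈ ic (Prod.fst '' P - Prod.fst '' Q))
    (hPQ : ∀ z r s, (z, r) ∈ P → (z, s) ∈ Q → 0 ≤ r + s) :
    ∃ (φ : StrongDual ℝ E) (c : ℝ), (∀ p ∈ P, φ p.1 + c ≤ p.2) ∧ ∀ q ∈ Q, -q.2 ≤ φ q.1 + c := by
  obtain ⟨h0S, hcl, habs⟩ := mem_ic_iff.1 h0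
  set S := Prod.fst '' P - Prod.fst '' Q with hS
  set V := vectorSpan ℝ S
  have hV : IsClosed (V : Set E) := by
    rwa [← AffineSubspace.isClosed_direction_iff, direction_affineSpan] at hcl
  have hSV : ∀ v ∈ S, v ∈ V := fun v hv => by
    simpa using vsub_mem_vectorSpan ℝ hv h0S
  let T : (E × ℝ) × (E × ℝ) →L[ℝ] E :=
    (ContinuousLinearMap.fst ℝ E ℝ).comp (ContinuousLinearMap.fst ℝ _ _) -
    (ContinuousLinearMap.fst ℝ E ℝ).comp (ContinuousLinearMap.snd ℝ _ _)
  have hT : T '' (P ×ˢ Q) = S := by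
    ext v
    constructor
    · rintro ⟨⟨p, q⟩, ⟨hp, hq⟩, rfl⟩
      exact ⟨p.1, ⟨p, hp, rfl⟩, q.1, ⟨q, hq, rfl⟩, rfl⟩
    · rintro ⟨_, ⟨p, hp, rfl⟩, _, ⟨q, hq, rfl⟩, rfl⟩
      exact ⟨(p, q), ⟨hp, hq⟩, rfl⟩
  obtain ⟨r, hr, N, hN⟩ := exists_ball_subset_image T (hP.prod hQ) (hPc.prod hQc) V hV
    (fun k hk => hSV _ (hT ▸ Set.mem_image_of_mem T hk)) (by simpa [hT] using habs)
  have hball : ∀ v ∈ V, ‖v‖ ≤ r → ∃ p ∈ P, ∃ q ∈ Q, v = p.1 - q.1 ∧ p.2 + q.2 ≤ 2 * N := by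
    intro v hv hvr
    obtain ⟨⟨p, q⟩, ⟨hp, hq⟩, hpq, rfl⟩ := hN v hv hvr
    refine ⟨p, hp, q, hq, rfl, ?_⟩
    have h1 := (le_abs_self _).trans ((norm_snd_le p).trans ((norm_fst_le (p, q)).trans hpq))
    have h2 := (le_abs_self _).trans ((norm_snd_le q).trans ((norm_snd_le (p, q)).trans hpq))
    linarith
  -- Essentially the epigraph of the value function v ↦ inf (p.2 + q.2) over p.1 - q.1 = v; it is
  -- bounded above near 0 by `hball`.
  let A : Set (V × ℝ) := {w | ∃ p ∈ P, ∃ q ∈ Q, (w.1 : E) = p.1 - q.1 ∧ p.2 + q.2 ≤ w.2}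
  have hA : Convex ℝ A := by
    rintro w ⟨p, hp, q, hq, hw, hle⟩ w' ⟨p', hp', q', hq', hw', hle'⟩ a b ha hb hab
    refine ⟨_, hPc hp hp' ha hb hab, _, hQc hq hq' ha hb hab, ?_, ?_⟩
    · simp only [Prod.fst_add, Prod.smul_fst, Submodule.coe_add, Submodule.coe_smul, hw, hw']
      module
    · simp only [Prod.snd_add, Prod.smul_snd, smul_eq_mul]
      nlinarith
  have hA0 : (0 : V × ℝ) ∉ interior A := by
    intro h
    obtain ⟨ε, hε, hsub⟩ := Metric.isOpen_iff.1 isOpen_interior _ h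
    have h1 : ((0 : V), -(ε / 2)) ∈ A := by
      refine interior_subset (hsub ?_)
      simp [dist_eq_norm, Prod.norm_def, abs_of_pos hε, hε]
    obtain ⟨p, hp, q, hq, hw, hle⟩ := h1
    have h2 : p.1 = q.1 := by simpa [sub_eq_zero, eq_comm] using hw
    have h3 := hPQ p.1 p.2 q.2 hp (by rw [h2]; exact hq)
    simp only at hle
    linarith
  have hAball : ∀ w : V × ℝ, ‖w.1‖ ≤ r → 2 * N ≤ w.2 → w ∈ A := by
    intro w hw hw2
    obtain ⟨p, hp, q, hq, h, h'⟩ := hball w.1 w.1.2 hw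
    exact ⟨p, hp, q, hq, h, h'.trans hw2⟩
  have hAint : (interior A).Nonempty := by
    refine ⟨(0, 2 * N + 1), interior_maximal (s := A) (t := Metric.ball 0 r ×ˢ Set.Ioi (2 * N))
      ?_ (Metric.isOpen_ball.prod isOpen_Ioi) ⟨by simpa using hr, by simp⟩⟩
    rintro w ⟨hw, hw2⟩
    exact hAball w (by simpa using (mem_ball_zero_iff.1 hw).le) (le_of_lt hw2)
  obtain ⟨f, hf, hfA⟩ := geometric_hahn_banach_of_nonempty_interior_point hA hA0 hAint
  rw [map_zero] at hfA
  set k : ℝ := f (0, 1) with hk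
  have hfk : ∀ w : V × ℝ, f w = f (w.1, 0) + w.2 * k := by
    intro w
    rw [hk, ← smul_eq_mul, ← map_smul, ← map_add]
    simp
  -- The separating hyperplane is not vertical: if k = 0, then f ≤ 0 on a ball of V, hence f = 0.
  have hk0 : k < 0 := by
    have h1 : k ≤ 0 := by
      have h2 := hfA (0, max (2 * N) 1) (hAball _ (by simpa using hr.le) (le_max_left _ _))
      rw [hfk] at h2
      have h3 : (0 : ℝ) < max (2 * N) 1 := lt_of_lt_of_le one_pos (le_max_right _ _)
      have h4 : f ((0 : V), (0 : ℝ)) = 0 := map_zero f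
      simp only [h4, zero_add] at h2
      by_contra! h5
      exact absurd h2 (not_le.2 (mul_pos h3 h5))
    refine lt_of_le_of_ne h1 fun hk0 => hf ?_
    have h2 : ∀ v : V, f (v, 0) ≤ 0 := by
      intro v
      have hv : 0 < ‖v‖ + 1 := by positivity
      have h3 := hfA ((r / (‖v‖ + 1)) • v, 2 * N) (hAball _ (by
        rw [norm_smul, Real.norm_of_nonneg (by positivity), div_mul_eq_mul_div,
          div_le_iff₀ hv]
        nlinarith) le_rfl)
      rw [hfk, hk0, mul_zero, add_zero] at h3
      have h4 : (((r / (‖v‖ + 1)) • v, 0) : V × ℝ) = (r / (‖v‖ + 1)) • (v, 0) := by simp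
      rw [h4, map_smul, smul_eq_mul] at h3
      have h5 : 0 < r / (‖v‖ + 1) := by positivity
      by_contra! h6
      exact absurd h3 (not_le.2 (mul_pos h5 h6))
    ext w
    · refine le_antisymm (h2 w) ?_
      have h3 := h2 (-w)
      have h4 : ((-w, 0) : V × ℝ) = -(w, 0) := by simp
      rw [h4, map_neg] at h3
      change (0 : ℝ) ≤ f (w, 0)
      linarith
    · simpa [hk] using hk0
  obtain ⟨φ, hφ, -⟩ := exists_extension_norm_eq V
    ((-k⁻¹) • f.comp (ContinuousLinearMap.inl ℝ V ℝ))
  have hφ' : ∀ p ∈ P, ∀ q ∈ Q, φ p.1 - φ q.1 ≤ p.2 + q.2 := by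
    intro p hp q hq
    have hv : p.1 - q.1 ∈ V := hSV _ ⟨p.1, ⟨p, hp, rfl⟩, q.1, ⟨q, hq, rfl⟩, rfl⟩
    have h1 := hfA (⟨p.1 - q.1, hv⟩, p.2 + q.2) ⟨p, hp, q, hq, rfl, le_rfl⟩
    have h2 : φ (p.1 - q.1) = -k⁻¹ * f (⟨p.1 - q.1, hv⟩, 0) := hφ ⟨p.1 - q.1, hv⟩
    rw [hfk] at h1
    rw [← map_sub, h2, neg_mul, inv_mul_eq_div, ← div_neg, div_le_iff₀ (by linarith)]
    linarith
  obtain ⟨_, ⟨p₀, hp₀, rfl⟩, _, ⟨q₀, hq₀, rfl⟩, -⟩ := h0S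
  obtain ⟨c, hc1, hc2⟩ := exists_between_of_forall_le (s := (fun q : E × ℝ => -q.2 - φ q.1) '' Q)
    (t := (fun p : E × ℝ => p.2 - φ p.1) '' P) ⟨_, q₀, hq₀, rfl⟩ ⟨_, p₀, hp₀, rfl⟩ (by
      rintro _ ⟨q, hq, rfl⟩ _ ⟨p, hp, rfl⟩
      have := hφ' p hp q hq
      simp only
      linarith)
  refine ⟨φ, c, fun p hp => ?_, fun q hq => ?_⟩
  · have := hc2 ⟨p, hp, rfl⟩
    simp only at this
    linarith
  · have := hc1 ⟨q, hq, rfl⟩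
    simp only at this
    linarith

end Convex

section Convex

theorem isClosed_epigraph_coe {E : Type*} [TopologicalSpace E] {f : E → EReal}
    (hf : LowerSemicontinuous f) : IsClosed {p : E × ℝ | f p.1 ≤ (p.2 : EReal)} :=
  hf.isClosed_epigraph.preimage (f := fun p : E × ℝ => (p.1, (p.2 : EReal)))
    (continuous_fst.prodMk (continuous_coe_real_ereal.comp continuous_snd))

theorem exists_coe_of_mem_effDom {E : Type*} {f : E → EReal} (hf : ∀ x, f x ≠ ⊥) {x : E}
    (hx : x ∈ effDom f) : ∃ r : ℝ, f x = r :=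
  ⟨(f x).toReal, (EReal.coe_toReal (ne_of_lt hx) (hf x)).symm⟩

variable {E : Type*} [NormedAddCommGroup E] [NormedSpace ℝ E]

theorem IsConvexFun.le_coe {f : E → EReal} (hf : IsConvexFun f) {x y : E} {r s a b : ℝ}
    (hx : f x ≤ r) (hy : f y ≤ s) (ha : 0 < a) (hb : 0 < b) (hab : a + b = 1) :
    f (a • x + b • y) ≤ ((a * r + b * s : ℝ) : EReal) := by
  refine (hf x y a b ha hb hab).trans ?_
  rw [EReal.coe_add, EReal.coe_mul, EReal.coe_mul]
  exact add_le_add (mul_le_mul_of_nonneg_left hx (EReal.coe_nonneg.2 ha.le))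
    (mul_le_mul_of_nonneg_left hy (EReal.coe_nonneg.2 hb.le))

theorem IsConvexFun.convex_epigraph {f : E → EReal} (hf : IsConvexFun f) :
    Convex ℝ {p : E × ℝ | f p.1 ≤ (p.2 : EReal)} := by
  rw [convex_iff_forall_pos]
  intro p hp q hq a b ha hb hab
  exact hf.le_coe hp hq ha hb hab

theorem IsConvexFun.convex_effDom {f : E → EReal} (hf : IsConvexFun f) (hb : ∀ x, f x ≠ ⊥) :
    Convex ℝ (effDom f) := by
  rw [convex_iff_forall_pos]
  intro x hx y hy a b ha hb' hab
  obtain ⟨r, hr⟩ := exists_coe_of_mem_effDom hb hx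
  obtain ⟨s, hs⟩ := exists_coe_of_mem_effDom hb hy
  exact (hf.le_coe hr.le hs.le ha hb' hab).trans_lt (EReal.coe_lt_top _)

end Convex

/-! ### Maximality, the Fitzpatrick bound and conjugates -/

section Operators

variable {X : Type*} [NormedAddCommGroup X] [NormedSpace ℝ X]

/-- Members of the graph of a maximal monotone operator are characterised by being monotonically
related to it. -/
theorem IsMaximalMonotoneOp.mem_graph {A : X → Set (StrongDual ℝ X)} (hA : IsMaximalMonotoneOp A)
    {p : X × StrongDual ℝ X} (hp : ∀ q ∈ graph A, 0 ≤ (p.2 - q.2) (p.1 - q.1)) : p ∈ graph A := by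
  let T : X → Set (StrongDual ℝ X) := fun x => {xs | xs ∈ A x ∨ (x, xs) = p}
  have hT : ∀ q, q ∈ graph T ↔ q ∈ graph A ∨ q = p := fun q => Iff.rfl
  have hmono : IsMonotoneOp T := by
    intro q hq q' hq'
    rcases (hT q).1 hq with h | h <;> rcases (hT q').1 hq' with h' | h'
    · exact hA.1 q h q' h'
    · subst h'
      have := hp q h
      rw [← neg_sub q.1, ← neg_sub q.2, map_neg, neg_apply, neg_neg] at this
      exact this
    · subst h
      exact hp q' h'
    · simp [h, h']
  rw [← hA.2 T hmono fun q hq => (hT q).2 (Or.inl hq)]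
  exact (hT p).2 (Or.inr rfl)

theorem IsMaximalMonotoneOp.graph_nonempty {A : X → Set (StrongDual ℝ X)}
    (hA : IsMaximalMonotoneOp A) : (graph A).Nonempty := by
  by_contra h
  rw [Set.not_nonempty_iff_eq_empty] at h
  have h0 : (0 : X × StrongDual ℝ X) ∈ graph A := hA.mem_graph (by simp [h])
  simp [h] at h0

theorem IsReflexiveSpace.exists_dualPair (hX : IsReflexiveSpace X)
    (φ : StrongDual ℝ (X × StrongDual ℝ X)) :
    ∃ (w : X) (ws : StrongDual ℝ X), ∀ p, φ p = ws p.1 + p.2 w := by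
  obtain ⟨w, hw⟩ := hX (φ.comp (ContinuousLinearMap.inr ℝ X (StrongDual ℝ X)))
  refine ⟨w, φ.comp (ContinuousLinearMap.inl ℝ X (StrongDual ℝ X)), fun p => ?_⟩
  have h1 : p.2 w = φ (0, p.2) := by
    simpa using congrArg (fun f : StrongDual ℝ (StrongDual ℝ X) => f p.2) hw
  have h2 : (ContinuousLinearMap.comp φ (ContinuousLinearMap.inl ℝ X (StrongDual ℝ X))) p.1
      = φ (p.1, 0) := rfl
  rw [h1, h2, ← map_add]
  simp

namespace IsRepresentative

variable {F : X × StrongDual ℝ X → EReal} {A : X → Set (StrongDual ℝ X)}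

theorem graph_subset_effDom (hF : IsRepresentative F A) : graph A ⊆ effDom F := by
  intro p hp
  rw [hF.graph_eq] at hp
  exact (le_of_eq hp).trans_lt (EReal.coe_lt_top _)

/-- A representative dominates the Fitzpatrick function. -/
theorem fitzpatrick_le (hF : IsRepresentative F A) {p a : X × StrongDual ℝ X} (ha : a ∈ graph A)
    {r : ℝ} (hp : F p ≤ r) : a.2 p.1 + p.2 a.1 - a.2 a.1 ≤ r := by
  rw [hF.graph_eq] at ha
  -- Compare the pairing with F on the segment from a to p: the two agree at a, so a factor s
  -- cancels before s → 0.
  have key : ∀ s ∈ Set.Ioo (0 : ℝ) 1,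
      (1 - s) * (a.2 p.1 + p.2 a.1 - a.2 a.1) + s * p.2 p.1 ≤ r := by
    rintro s ⟨hs0, hs1⟩
    have h1 := hF.convex.le_coe (le_of_eq ha) hp (by linarith : 0 < 1 - s) hs0 (by ring)
    have h2 := (hF.ge_pairing ((1 - s) • a.1 + s • p.1) ((1 - s) • a.2 + s • p.2)).trans h1
    rw [EReal.coe_le_coe_iff] at h2
    simp only [map_add, map_smul, smul_eq_mul, add_apply,
      smul_apply] at h2
    refine le_of_mul_le_mul_left ?_ hs0
    linarith
  have hlim : Filter.Tendsto (fun s : ℝ =>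
      (1 - s) * (a.2 p.1 + p.2 a.1 - a.2 a.1) + s * p.2 p.1) (nhdsWithin 0 (Set.Ioi 0))
      (nhds (a.2 p.1 + p.2 a.1 - a.2 a.1)) := by
    have h : Continuous fun s : ℝ =>
      (1 - s) * (a.2 p.1 + p.2 a.1 - a.2 a.1) + s * p.2 p.1 := by fun_prop
    simpa using (h.tendsto 0).mono_left nhdsWithin_le_nhds
  refine le_of_tendsto hlim ?_
  filter_upwards [Ioo_mem_nhdsGT (zero_lt_one' ℝ)] with s hs using key s hs

/-- If the conjugate of a representative is at most the pairing at a point, then this point belongs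
to the graph of the represented operator. -/
theorem mem_graph_of_forall_le (hF : IsRepresentative F A) (hA : IsMaximalMonotoneOp A)
    {y : X} {ys : StrongDual ℝ X}
    (h : ∀ p, ∀ r : ℝ, F p ≤ r → ys p.1 + p.2 y - r ≤ ys y) : (y, ys) ∈ graph A := by
  refine hA.mem_graph fun q hq => ?_
  rw [hF.graph_eq] at hq
  have := h q _ (le_of_eq hq)
  simp only [sub_apply, map_sub]
  linarith

/-- A real upper bound of the conjugate is at least the pairing. -/
theorem pairing_le_of_forall_le (hF : IsRepresentative F A) {y : X} {ys : StrongDual ℝ X} {c : ℝ}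
    (h : ∀ p, ∀ r : ℝ, F p ≤ r → ys p.1 + p.2 y - r ≤ c) : ys y ≤ c := by
  rw [← EReal.coe_le_coe_iff]
  refine (hF.conj_ge_pairing y ys).trans (iSup_le fun p => ?_)
  have hd : dualPair ys y p = ys p.1 + p.2 y := by simp [dualPair]
  rw [hd]
  by_cases hp : F p = ⊤
  · simp [hp]
  · obtain ⟨r, hr⟩ := exists_coe_of_mem_effDom hF.ne_bot (lt_top_iff_ne_top.2 hp)
    rw [hr, ← EReal.coe_sub, EReal.coe_le_coe_iff]
    exact h p r hr.le

end IsRepresentative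

end Operators

section Convex

variable {E : Type*} [NormedAddCommGroup E] [NormedSpace ℝ E]

theorem zero_mem_ic_neg_vadd {D : Set E} {a : E} (ha : a ∈ ic D) : 0 ∈ ic (-a +ᵥ D) := by
  obtain ⟨haD, hcl, h⟩ := mem_ic_iff.1 ha
  have hmem : ∀ v, v ∈ -a +ᵥ D ↔ a + v ∈ D := fun v => by
    rw [Set.mem_vadd_set_iff_neg_vadd_mem, neg_neg, vadd_eq_add]
  have hvec : vectorSpan ℝ (-a +ᵥ D) = vectorSpan ℝ D := vectorSpan_vadd ℝ D (-a)
  refine mem_ic_iff.2 ⟨(hmem 0).2 (by simpa using haD), ?_, fun x hx => ?_⟩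
  · rw [← AffineSubspace.isClosed_direction_iff, direction_affineSpan] at hcl ⊢
    rwa [hvec]
  · obtain ⟨δ, hδ, h⟩ := h x (hvec ▸ hx)
    exact ⟨δ, hδ, fun t ht => (hmem _).2 (by simpa using h t ht)⟩

/-- A continuous linear functional bounded above on the affine span of a set is constant on the
set. -/
theorem eq_of_forall_mem_affineSpan_lt {C : Set E} {f : StrongDual ℝ E} {u : ℝ}
    (h : ∀ x ∈ affineSpan ℝ C, f x < u) {x y : E} (hx : x ∈ C) (hy : y ∈ C) : f x = f y := by
  by_contra hne
  have hne' : f y - f x ≠ 0 := sub_ne_zero.2 (Ne.symm hne)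
  have h1 := h _ (AffineMap.lineMap_mem ((u - f x) / (f y - f x)) (subset_affineSpan ℝ C hx)
    (subset_affineSpan ℝ C hy))
  rw [AffineMap.lineMap_apply_module', map_add, map_smul, map_sub, smul_eq_mul,
    div_mul_cancel₀ _ hne'] at h1
  linarith

end Convex

/-! ### Functionals constant on a graph, and the main inclusions -/

section Operators

variable {X : Type*} [NormedAddCommGroup X] [NormedSpace ℝ X]

theorem mem_graph_neg {B : X → Set (StrongDual ℝ X)} {p : X × StrongDual ℝ X} :
    p ∈ graph (-B) ↔ (p.1, -p.2) ∈ graph B := Iff.rfl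

/-- If a functional `(w*, w)` is constant on the graph of a maximal monotone operator and
`⟨w, w*⟩ ≥ 0`, then the graph is invariant under translations along `(w, w*)`. -/
theorem IsMaximalMonotoneOp.add_smul_mem_graph {A : X → Set (StrongDual ℝ X)}
    (hA : IsMaximalMonotoneOp A) {w : X} {ws : StrongDual ℝ X} {α : ℝ}
    (hα : ∀ p ∈ graph A, ws p.1 + p.2 w = α) (hw : 0 ≤ ws w) {p : X × StrongDual ℝ X}
    (hp : p ∈ graph A) (t : ℝ) : (p.1 + t • w, p.2 + t • ws) ∈ graph A := by
  refine hA.mem_graph fun q hq => ?_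
  have h1 := hA.1 p hp q hq
  have h2 := hα p hp
  have h3 := hα q hq
  simp only [sub_apply, add_apply, smul_apply, map_sub, map_add, map_smul, smul_eq_mul] at h1 ⊢
  have h4 : 0 ≤ t * (t * ws w) := by rw [← mul_assoc]; exact mul_nonneg (mul_self_nonneg t) hw
  have h5 : t * (ws p.1 + p.2 w) = t * (ws q.1 + q.2 w) := by rw [h2, h3]
  linarith

/-- If ⟨w, w*⟩ > 0, translating by (w, w*) would stay in the graph yet raise the functional by 2⟨w,
w*⟩. -/
theorem IsMaximalMonotoneOp.pairing_nonpos {A : X → Set (StrongDual ℝ X)}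
    (hA : IsMaximalMonotoneOp A) {w : X} {ws : StrongDual ℝ X} {α : ℝ}
    (hα : ∀ p ∈ graph A, ws p.1 + p.2 w = α) : ws w ≤ 0 := by
  by_contra! hw
  obtain ⟨p, hp⟩ := hA.graph_nonempty
  have h1 := hα _ (hA.add_smul_mem_graph hα hw.le hp 1)
  have h2 := hα p hp
  simp only [add_apply, smul_apply, map_add, map_smul, smul_eq_mul] at h1
  linarith

namespace IsRepresentative

variable {F : X × StrongDual ℝ X → EReal} {A : X → Set (StrongDual ℝ X)}

/-- Moving the graph point a by t (w, w*) adds t (⟨p₁, w*⟩ + ⟨w, p₂⟩ - α) to the Fitzpatrick bound,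
for every real t; finiteness of F p kills the factor. -/
theorem eq_on_effDom (hF : IsRepresentative F A) (hA : IsMaximalMonotoneOp A) {w : X}
    {ws : StrongDual ℝ X} {α : ℝ} (hα : ∀ p ∈ graph A, ws p.1 + p.2 w = α) (hw : ws w = 0)
    {p : X × StrongDual ℝ X} (hp : p ∈ effDom F) : ws p.1 + p.2 w = α := by
  obtain ⟨r, hr⟩ := exists_coe_of_mem_effDom hF.ne_bot hp
  obtain ⟨a, ha⟩ := hA.graph_nonempty
  by_contra hne
  have hne' : ws p.1 + p.2 w - α ≠ 0 := sub_ne_zero.2 hne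
  set t : ℝ := (r + 1 - (a.2 p.1 + p.2 a.1 - a.2 a.1)) / (ws p.1 + p.2 w - α) with ht
  have h1 := hF.fitzpatrick_le (hA.add_smul_mem_graph hα hw.ge ha t) hr.le
  have h2 : t * (ws p.1 + p.2 w - α) = r + 1 - (a.2 p.1 + p.2 a.1 - a.2 a.1) :=
    div_mul_cancel₀ _ hne'
  have h3 := hα a ha
  simp only [add_apply, smul_apply, map_add, map_smul, smul_eq_mul, hw] at h1
  rw [← h3] at h2
  linarith

theorem graph_neg_subset_effDom_hat (hF : IsRepresentative F A) :
    graph (-A) ⊆ effDom (hat F) := fun _ hp => hF.graph_subset_effDom (mem_graph_neg.1 hp)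

theorem isConvexFun_hat (hF : IsRepresentative F A) : IsConvexFun (hat F) := by
  intro x y a b ha hb hab
  have h : ((a • x + b • y).1, -(a • x + b • y).2)
      = a • (x.1, -x.2) + b • (y.1, -y.2) := by
    ext1
    · rfl
    · change -(a • x.2 + b • y.2) = a • -x.2 + b • -y.2
      module
  rw [hat, h]
  exact hF.convex _ _ a b ha hb hab

theorem lowerSemicontinuous_hat (hF : IsRepresentative F A) : LowerSemicontinuous (hat F) :=
  hF.lsc.comp (g := fun p : X × StrongDual ℝ X => (p.1, -p.2)) (by fun_prop)

end IsRepresentative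

variable {A B : X → Set (StrongDual ℝ X)} {F₁ F₂ : X × StrongDual ℝ X → EReal}

/-- The difference of the domains of representatives lies in the closed affine hull of the
difference of the graphs. -/
theorem effDom_sub_subset_closure (hX : IsReflexiveSpace X)
    (hA : IsMaximalMonotoneOp A) (hB : IsMaximalMonotoneOp B)
    (hF₁ : IsRepresentative F₁ A) (hF₂ : IsRepresentative F₂ B) :
    effDom F₁ - effDom (hat F₂) ⊆
      closure (affineSpan ℝ (graph A - graph (-B)) : Set (X × StrongDual ℝ X)) := by
  rintro _ ⟨p, hp, q, hq, rfl⟩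
  by_contra hd
  obtain ⟨f, u, hf, hu⟩ := geometric_hahn_banach_closed_point
    (AffineSubspace.convex _).closure isClosed_closure hd
  have hconst : ∀ x ∈ graph A - graph (-B), ∀ y ∈ graph A - graph (-B), f x = f y :=
    fun x hx y hy => eq_of_forall_mem_affineSpan_lt (fun z hz => hf z (subset_closure hz)) hx hy
  obtain ⟨w, ws, hw⟩ := hX.exists_dualPair f
  obtain ⟨a, ha⟩ := hA.graph_nonempty
  obtain ⟨b, hb⟩ := hB.graph_nonempty
  have hb' : (b.1, -b.2) ∈ graph (-B) := mem_graph_neg.2 (by simpa using hb)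
  have hαA : ∀ p ∈ graph A, ws p.1 + p.2 w = f a := by
    intro p hp
    have h1 := hconst _ ⟨p, hp, _, hb', rfl⟩ _ ⟨a, ha, _, hb', rfl⟩
    simp only [map_sub] at h1
    rw [← hw]
    linarith
  have hαB : ∀ q ∈ graph B, (-ws) q.1 + q.2 w = - f (b.1, -b.2) := by
    intro q hq
    have hq' : (q.1, -q.2) ∈ graph (-B) := mem_graph_neg.2 (by simpa using hq)
    have h1 := hconst _ ⟨a, ha, _, hq', rfl⟩ _ ⟨a, ha, _, hb', rfl⟩
    simp only [map_sub] at h1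
    have h2 := hw (q.1, -q.2)
    simp only [neg_apply] at h2 ⊢
    linarith
  -- The sign flip in gra(-B) turns (w*, w) into (-w*, w) for B, so the two operators give opposite
  -- inequalities.
  have hw0 : ws w = 0 := by
    have h1 := hA.pairing_nonpos hαA
    have h2 := hB.pairing_nonpos hαB
    rw [neg_apply] at h2
    linarith
  have h1 := hF₁.eq_on_effDom hA hαA hw0 hp
  have h2 := hF₂.eq_on_effDom hB hαB (by simp [hw0]) (p := (q.1, -q.2)) hq
  rw [← hw] at h1
  have h3 : f q = f (b.1, -b.2) := by
    rw [hw q]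
    simp only [neg_apply] at h2
    linarith
  refine absurd (hf (a - (b.1, -b.2)) (subset_closure (subset_affineSpan ℝ _
    ⟨a, ha, _, hb', rfl⟩))) (not_lt.2 ?_)
  have h4 : f (a - (b.1, -b.2)) = f (p - q) := by rw [map_sub, map_sub, h1, h3]
  rw [h4]
  exact hu.le

/-- Every point of `ic` of the difference of the domains is a difference of points of the graphs. -/
theorem ic_effDom_sub_subset [CompleteSpace X] (hX : IsReflexiveSpace X)
    (hA : IsMaximalMonotoneOp A) (hB : IsMaximalMonotoneOp B)
    (hF₁ : IsRepresentative F₁ A) (hF₂ : IsRepresentative F₂ B) :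
    ic (effDom F₁ - effDom (hat F₂)) ⊆ graph A - graph (-B) := by
  intro a ha
  let ℓ : StrongDual ℝ (X × StrongDual ℝ X) := dualPair a.2 a.1
  have hℓ : ∀ z, ℓ z = a.2 z.1 + z.2 a.1 := fun z => by simp [ℓ, dualPair]
  let P : Set ((X × StrongDual ℝ X) × ℝ) := {p | F₁ p.1 ≤ (p.2 : EReal)}
  let R : Set ((X × StrongDual ℝ X) × ℝ) := {p | hat F₂ p.1 ≤ (p.2 : EReal)}
  -- `g ⁻¹' R` is the epigraph of z ↦ F̂₂(z - a) - ℓ z + ⟨a₁, a₂⟩. The tilt makes the lower bounds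
  -- by the pairings of F₁ and F₂ sum to exactly 0.
  let g : (X × StrongDual ℝ X) × ℝ → (X × StrongDual ℝ X) × ℝ :=
    fun q => (q.1 - a, q.2 + ℓ q.1 - a.2 a.1)
  have hPc : Convex ℝ P := hF₁.convex.convex_epigraph
  have hQc : Convex ℝ (g ⁻¹' R) := by
    intro q hq q' hq' s t hs ht hst
    have h1 := hF₂.isConvexFun_hat.convex_epigraph hq hq' hs ht hst
    have h2 : g (s • q + t • q') = s • g q + t • g q' := by
      obtain rfl : s = 1 - t := by linarith
      ext1
      · simp only [g, Prod.fst_add, Prod.smul_fst]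
        module
      · simp only [g, Prod.fst_add, Prod.smul_fst, Prod.snd_add, Prod.smul_snd, map_add, map_smul,
          smul_eq_mul]
        ring
    rw [Set.mem_preimage, h2]
    exact h1
  have hQ : IsClosed (g ⁻¹' R) :=
    (isClosed_epigraph_coe hF₂.lowerSemicontinuous_hat).preimage (by fun_prop)
  have hPfst : Prod.fst '' P = effDom F₁ := by
    ext z
    constructor
    · rintro ⟨p, hp, rfl⟩
      exact lt_of_le_of_lt hp (EReal.coe_lt_top _)
    · intro hz
      obtain ⟨r, hr⟩ := exists_coe_of_mem_effDom hF₁.ne_bot hz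
      exact ⟨(z, r), hr.le, rfl⟩
  have hQfst : Prod.fst '' (g ⁻¹' R) = a +ᵥ effDom (hat F₂) := by
    ext z
    rw [Set.mem_vadd_set_iff_neg_vadd_mem, vadd_eq_add, neg_add_eq_sub]
    constructor
    · rintro ⟨p, hp, rfl⟩
      exact lt_of_le_of_lt hp (EReal.coe_lt_top _)
    · intro hz
      obtain ⟨r, hr⟩ := exists_coe_of_mem_effDom (f := hat F₂)
        (fun x => hF₂.ne_bot (x.1, -x.2)) hz
      refine ⟨(z, r - ℓ z + a.2 a.1), ?_, rfl⟩
      change hat F₂ (z - a) ≤ ((r - ℓ z + a.2 a.1 + ℓ z - a.2 a.1 : ℝ) : EReal)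
      rw [show r - ℓ z + a.2 a.1 + ℓ z - a.2 a.1 = r by ring]
      exact hr.le
  have h0 : 0 ∈ ic (Prod.fst '' P - Prod.fst '' (g ⁻¹' R)) := by
    have h1 : Prod.fst '' P - Prod.fst '' (g ⁻¹' R)
        = -a +ᵥ (effDom F₁ - effDom (hat F₂)) := by
      rw [hPfst, hQfst]
      ext z
      simp only [Set.mem_sub, Set.mem_vadd_set, vadd_eq_add]
      constructor
      · rintro ⟨x, hx, _, ⟨y, hy, rfl⟩, rfl⟩
        exact ⟨_, ⟨x, hx, y, hy, rfl⟩, by abel⟩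
      · rintro ⟨_, ⟨x, hx, y, hy, rfl⟩, rfl⟩
        exact ⟨x, hx, _, ⟨y, hy, rfl⟩, by abel⟩
    rw [h1]
    exact zero_mem_ic_neg_vadd ha
  obtain ⟨φ, c, hP, hR⟩ := exists_affine_between (isClosed_epigraph_coe hF₁.lsc) hPc hQ hQc h0 (by
    intro z r s hr hs
    have h1 := (hF₁.ge_pairing z.1 z.2).trans hr
    have h2 := (hF₂.ge_pairing (z.1 - a.1) (-(z.2 - a.2))).trans hs
    rw [EReal.coe_le_coe_iff] at h1 h2
    simp only [hℓ, g, neg_apply, sub_apply, map_sub] at h1 h2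
    linarith)
  obtain ⟨y, ys, hφ⟩ := hX.exists_dualPair φ
  have hc₁ : ∀ p, ∀ r : ℝ, F₁ p ≤ r → ys p.1 + p.2 y - r ≤ -c := by
    intro p r hpr
    have := hP (p, r) hpr
    rw [hφ] at this
    linarith
  have hc₂ : ∀ p, ∀ r : ℝ, F₂ p ≤ r → (a.2 - ys) p.1 + p.2 (y - a.1) - r
      ≤ ys a.1 + a.2 y + c - a.2 a.1 := by
    intro p r hpr
    have := hR ((p.1 + a.1, a.2 - p.2), r - ℓ (p.1 + a.1, a.2 - p.2) + a.2 a.1) (by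
      change F₂ (p.1 + a.1 - a.1, -(a.2 - p.2 - a.2)) ≤ ((r - ℓ (p.1 + a.1, a.2 - p.2) + a.2 a.1
        + ℓ (p.1 + a.1, a.2 - p.2) - a.2 a.1 : ℝ) : EReal)
      rw [show r - ℓ (p.1 + a.1, a.2 - p.2) + a.2 a.1 + ℓ (p.1 + a.1, a.2 - p.2) - a.2 a.1 = r by
        ring]
      simpa using hpr)
    rw [hφ, hℓ] at this
    simp only [sub_apply, map_sub, map_add] at this ⊢
    linarith
  -- Together `h1` and `h2` give ⟨y, y*⟩ = -c, so each conjugate is at most the pairing at its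
  -- point.
  have h1 := hF₁.pairing_le_of_forall_le hc₁
  have h2 := hF₂.pairing_le_of_forall_le hc₂
  simp only [sub_apply, map_sub] at h2
  have hyA : (y, ys) ∈ graph A := hF₁.mem_graph_of_forall_le hA fun p r hpr =>
    (hc₁ p r hpr).trans (by linarith)
  have hyB : (y - a.1, a.2 - ys) ∈ graph B := hF₂.mem_graph_of_forall_le hB fun p r hpr =>
    (hc₂ p r hpr).trans (by simp only [sub_apply, map_sub]; linarith)
  exact ⟨(y, ys), hyA, (y - a.1, ys - a.2), mem_graph_neg.2 (by simpa using hyB), by simp⟩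

/-- The three sets of the sum theorem, built from the domains of representatives and from the
graphs, have the same `ic`. -/
theorem ic_effDom_sub_eq [CompleteSpace X] (hX : IsReflexiveSpace X)
    (hA : IsMaximalMonotoneOp A) (hB : IsMaximalMonotoneOp B)
    (hF₁ : IsRepresentative F₁ A) (hF₂ : IsRepresentative F₂ B) :
    ic (effDom F₁ - effDom (hat F₂)) = ic (convexHull ℝ (graph A - graph (-B))) ∧
      ic (convexHull ℝ (graph A - graph (-B))) = ic (graph A - graph (-B)) := by
  have hDc : Convex ℝ (effDom F₁ - effDom (hat F₂)) := (hF₁.convex.convex_effDom hF₁.ne_bot).sub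
    (hF₂.isConvexFun_hat.convex_effDom fun x : X × StrongDual ℝ X => hF₂.ne_bot (x.1, -x.2))
  have hCD : graph A - graph (-B) ⊆ effDom F₁ - effDom (hat F₂) :=
    Set.sub_subset_sub hF₁.graph_subset_effDom hF₂.graph_neg_subset_effDom_hat
  have h₁ : ic (effDom F₁ - effDom (hat F₂)) ⊆ ic (graph A - graph (-B)) :=
    ic_subset_ic_of_ic_subset hDc (ic_effDom_sub_subset hX hA hB hF₁ hF₂) hCD
  have h₂ : ic (graph A - graph (-B)) ⊆ ic (convexHull ℝ (graph A - graph (-B))) :=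
    ic_subset_ic_of_subset_closure (subset_convexHull ℝ _)
      ((convexHull_subset_affineSpan _).trans subset_closure)
  have h₃ : ic (convexHull ℝ (graph A - graph (-B))) ⊆ ic (effDom F₁ - effDom (hat F₂)) :=
    ic_subset_ic_of_subset_closure (convexHull_min hCD hDc) (by
      rw [affineSpan_convexHull]
      exact effDom_sub_subset_closure hX hA hB hF₁ hF₂)
  exact ⟨(h₁.trans h₂).antisymm h₃, (h₃.trans h₁).antisymm h₂⟩

end Operators

end MaxMono

end

theorem theorem2p6 {X : Type*} [NormedAddCommGroup X] [NormedSpace ℝ X] [CompleteSpace X]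
    (hX : MaxMono.IsReflexiveSpace X)
    (A B : X → Set (StrongDual ℝ X))
    (hA : MaxMono.IsMaximalMonotoneOp A) (hB : MaxMono.IsMaximalMonotoneOp B)
    (F₁ F₂ : X × StrongDual ℝ X → EReal)
    (hF₁ : MaxMono.IsRepresentative F₁ A) (hF₂ : MaxMono.IsRepresentative F₂ B) :
    MaxMono.ic (MaxMono.effDom F₁ - MaxMono.effDom (MaxMono.hat F₂))
        = MaxMono.ic (convexHull ℝ (MaxMono.graph A - MaxMono.graph (-B))) ∧
      MaxMono.ic (convexHull ℝ (MaxMono.graph A - MaxMono.graph (-B)))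
        = MaxMono.ic (MaxMono.graph A - MaxMono.graph (-B)) := by
  exact MaxMono.ic_effDom_sub_eq hX hA hB hF₁ hF₂
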